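/- Let $\Theta$ be a variety of algebras (finitary operations, constants allowed), let $X^0$ be an infinite set of variables and let $W(V)$ denote the free algebra of $\Theta$ over a set $V$ of variables. *The multi-sorted algebra of formulas.* For finite $X\subset X^0$ let $\mathfrak L^0(X)$ be the components of the absolutely free multi-sorted algebra generated by the equalities $w\equiv w'$ ($w,w'\in W(X)$), with the Boolean operations and the quantifiers $\exists x$ ($x\in X$) on each component, and with a unary operation $s_*:\mathfrak L^0(X)\to\mathfrak L^0(Y)$ for every homomorphism $s:W(X)\to W(Y)$. Let $\Phi(X)$ be the $X$-component of its quotient by the identities of the variety of multi-sorted Halmos algebras: each component is a Boolean algebra with commuting existential quantifiers $\exists x$ and with equalities that form a congruence on $W(X)$; $s\mapsto s_*$ is functorial and each $s_*$ is a Boolean homomorphism; $s_*\exists x\,a=s'_*\exists x\,a$ if $s$ and $s'$ agree on $X\setminus\{x\}$; $s_*\exists x\,a=\exists y\,s_*a$ if $s(x)=y\in Y$ and $s(x')$ lies in the subalgebra generated by $Y\setminus\{y\}$ for every $x'\in X\setminus\{x\}$; $s_*(w\equiv w')=(s(w)\equiv s(w'))$; and $(s^x_w)_*a\wedge(w\equiv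 w')\le(s^x_{w'})_*a$, where $s^x_w\in\operatorname{End}W(X)$ sends $x$ to $w$ and fixes the other variables. For an algebra $H\in\Theta$ let $Val^X_H(u)\subseteq Hom(W(X),H)$ be the value of $u\in\Phi(X)$: $Val^X_H(w\equiv w')=\{\mu:\mu(w)=\mu(w')\}$, Boolean operations are set-theoretic, $\mu\in Val^X_H(\exists x\,u)$ iff some $\nu\in Val^X_H(u)$ agrees with $\mu$ on $X\setminus\{x\}$, and $\mu\in Val^Y_H(s_*u)$ iff $\mu s\in Val^X_H(u)$, for $s:W(X)\to W(Y)$ and $u\in\Phi(X)$. The logical kernel of a point $\mu:W(X)\to H$ is $LKer(\mu)=\{u\in\Phi(X):\mu\in Val^X_H(u)\}$. *The one-sorted algebra of formulas.* Let $\Phi(X^0)$ be the Lindenbaum–Tarski algebra of the first-order formulas built from the equalities $w\equiv w'$ ($w,w'\in W(X^0)$) by the Boolean connectives and the quantifiers $\exists x$ ($x\in X^0$): two formulas are identified if their equivalence is deducible in first-order logic with equality. An element of $\Phi(X^0)$ is called $X$-special if it is represented by a formula whose free variables all belong to $X$ and whose bound variables all belong to $X^0\setminus X$. For a point $\mu:W(X)\to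 H$, the type $Tp^H(\mu)$ is the set of all $X$-special $u=u(x_1,\dots,x_n;y_1,\dots,y_m)\in\Phi(X^0)$ such that $u(\mu(x_1),\dots,\mu(x_n);y_1,\dots,y_m)$ is satisfied in $H$, i.e. such that every point $\eta:W(X^0)\to H$ with $\eta(x_i)=\mu(x_i)$ for all $x_i\in X$ satisfies $u$. **Theorem.** For every finite $X\subset X^0$, every formula $u\in\Phi(X)$ is correct: there is an $X$-special $\tilde u\in\Phi(X^0)$ such that for every (non-empty) algebra $H\in\Theta$ and every point $\mu:W(X)\to H$, $$u\in LKer(\mu)\iff \tilde u\in Tp^H(\mu).$$ -/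

import Mathlib

open FirstOrder

universe u v w x

namespace LogGeom

/-! ## Varieties of algebras and their free algebras

A signature of algebras is a first-order language without relation symbols; constants are the
operation symbols of arity `0`. -/

/-- A variety of algebras of signature `L`, presented by a set of identities `t = t'` between terms
in countably many variables. -/
structure Variety (L : FirstOrder.Language.{u, v}) where
  identities : Set (L.Term ℕ × L.Term ℕ)

/-- The algebra `H` belongs to the variety `Θ`: all identities of `Θ` hold in `H`. -/
class InVariety {L : FirstOrder.Language.{u, v}} (Θ : Variety L) (H : Type w) [L.Structure H] : Prop where
  holds : ∀ e ∈ Θ.identities, ∀ a : ℕ → H, e.1.realize a = e.2.realize a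

/-- The fully invariant congruence of the term algebra generated by the identities of `Θ`. -/
inductive TermEq {L : FirstOrder.Language.{u, v}} (Θ : Variety L) {α : Type x} :
    L.Term α → L.Term α → Prop
  | inst (e : L.Term ℕ × L.Term ℕ) (he : e ∈ Θ.identities) (σ : ℕ → L.Term α) :
      TermEq Θ (e.1.subst σ) (e.2.subst σ)
  | refl (t : L.Term α) : TermEq Θ t t
  | symm {t t' : L.Term α} : TermEq Θ t t' → TermEq Θ t' t
  | trans {t t' t'' : L.Term α} : TermEq Θ t t' → TermEq Θ t' t'' → TermEq Θ t t''
  | congr {n : ℕ} (f : L.Functions n) (ts ts' : Fin n → L.Term α) :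
      (∀ i, TermEq Θ (ts i) (ts' i)) →
        TermEq Θ (FirstOrder.Language.Term.func f ts) (FirstOrder.Language.Term.func f ts')

abbrev termSetoid {L : FirstOrder.Language.{u, v}} (Θ : Variety L) (α : Type x) : Setoid (L.Term α) where
  r := TermEq Θ
  iseqv := ⟨TermEq.refl, TermEq.symm, TermEq.trans⟩

/-- The term algebra, together with the congruence of `Θ`. -/
instance termPrestructure {L : FirstOrder.Language.{u, v}} [L.IsAlgebraic] (Θ : Variety L) (α : Type x) :
    L.Prestructure (termSetoid Θ α) where
  toStructure :=
    { funMap := fun f ts => FirstOrder.Language.Term.func f ts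
      RelMap := fun r _ => isEmptyElim r }
  fun_equiv := fun {_} {f} ts ts' h => TermEq.congr f ts ts' h
  rel_equiv := fun {_} {r} _ _ _ => isEmptyElim r

/-- `W Θ α` is the free algebra `W(α)` of the variety `Θ` over the set of variables `α`. -/
def W {L : FirstOrder.Language.{u, v}} (Θ : Variety L) (α : Type x) : Type (max u x) :=
  Quotient (termSetoid Θ α)

instance {L : FirstOrder.Language.{u, v}} [L.IsAlgebraic] (Θ : Variety L) (α : Type x) :
    L.Structure (W Θ α) :=
  inferInstanceAs (L.Structure (Quotient (termSetoid Θ α)))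

/-- The class of a term in `W(α)`. -/
def W.mk {L : FirstOrder.Language.{u, v}} (Θ : Variety L) {α : Type x} (t : L.Term α) : W Θ α :=
  Quotient.mk (termSetoid Θ α) t

/-- The variable `a`, as an element of `W(α)`. -/
def W.var {L : FirstOrder.Language.{u, v}} (Θ : Variety L) {α : Type x} (a : α) : W Θ α :=
  W.mk Θ (FirstOrder.Language.Term.var a)

theorem W.exists_mk {L : FirstOrder.Language.{u, v}} {Θ : Variety L} {α : Type x} (t : W Θ α) :
    ∃ r : L.Term α, W.mk Θ r = t :=
  Quotient.exists_rep t

section FreeFacts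

variable {L : FirstOrder.Language.{u, v}} {Θ : Variety L} {α : Type x} {H : Type w} [L.Structure H]

theorem TermEq.sound [InVariety Θ H] (a : α → H) {t t' : L.Term α} (h : TermEq Θ t t') :
    t.realize a = t'.realize a := by
  induction h with
  | inst e he σ =>
    rw [FirstOrder.Language.Term.realize_subst, FirstOrder.Language.Term.realize_subst]
    exact InVariety.holds e he _
  | refl t => rfl
  | symm _ ih => exact ih.symm
  | trans _ _ ih ih' => exact ih.trans ih'
  | congr f ts ts' _ ih => simp only [FirstOrder.Language.Term.realize, ih]

theorem W.exists_mk_family {ι : Type*} (ts : ι → W Θ α) :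
    ∃ rs : ι → L.Term α, ts = fun i => W.mk Θ (rs i) := by
  choose rs hrs using fun i => W.exists_mk (ts i)
  exact ⟨rs, funext fun i => (hrs i).symm⟩

variable [L.IsAlgebraic]

theorem W.funMap_mk {n : ℕ} (f : L.Functions n) (ts : Fin n → L.Term α) :
    FirstOrder.Language.Structure.funMap f (fun i => W.mk Θ (ts i))
      = W.mk Θ (FirstOrder.Language.Term.func f ts) :=
  FirstOrder.Language.funMap_quotient_mk' (termSetoid Θ α) f ts

/-- The universal property of the free algebra (existence). -/
def W.lift [InVariety Θ H] (a : α → H) : W Θ α →[L] H where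
  toFun := Quotient.lift (fun t : L.Term α => t.realize a) (fun _ _ h => TermEq.sound a h)
  map_fun' := by
    intro n f ts
    obtain ⟨ts', rfl⟩ := W.exists_mk_family ts
    rw [W.funMap_mk]
    rfl
  map_rel' := fun r _ => isEmptyElim r

theorem W.lift_var [InVariety Θ H] (a : α → H) (b : α) : W.lift a (W.var Θ b) = a b := rfl

/-- The universal property of the free algebra (uniqueness). -/
theorem W.hom_ext {f g : W Θ α →[L] H} (h : ∀ a, f (W.var Θ a) = g (W.var Θ a)) : f = g := by
  refine FirstOrder.Language.Hom.ext fun t => ?_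
  obtain ⟨t, rfl⟩ := W.exists_mk t
  induction t with
  | var a => exact h a
  | func F ts ih =>
    rw [← W.funMap_mk, FirstOrder.Language.Hom.map_fun, FirstOrder.Language.Hom.map_fun]
    exact congrArg _ (funext fun i => ih i)

/-- `W(α)` itself belongs to `Θ`. -/
instance W.inVariety : InVariety Θ (W Θ α) where
  holds := by
    intro e he a
    obtain ⟨σ, rfl⟩ := W.exists_mk_family a
    have key : ∀ t : L.Term ℕ, t.realize (fun i => W.mk Θ (σ i)) = W.mk Θ (t.subst σ) := by
      intro t
      induction t with
      | var i => rfl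
      | func F ts ih =>
        simp only [FirstOrder.Language.Term.realize, FirstOrder.Language.Term.subst, ih]
        exact W.funMap_mk F _
    rw [key, key]
    exact Quotient.sound (TermEq.inst e he σ)

end FreeFacts

/-- The subalgebra of `W(α)` generated by a set `S` of variables: the elements of `W(α)` that can be
written as `Θ`-words in variables from `S` only. -/
def wordsIn {L : FirstOrder.Language.{u, v}} [L.IsAlgebraic] (Θ : Variety L) {α : Type x} (S : Set α) :
    L.Substructure (W Θ α) :=
  FirstOrder.Language.Substructure.closure L (W.var Θ '' S)

open Classical in
/-- The endomorphism `s^a_t` of `W(α)` taking the variable `a` to `t` and fixing the others. -/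
noncomputable def W.single {L : FirstOrder.Language.{u, v}} [L.IsAlgebraic] {Θ : Variety L} {α : Type x}
    (a : α) (t : W Θ α) : W Θ α →[L] W Θ α :=
  W.lift (Function.update (W.var Θ) a t)

section PointFacts

variable {L : FirstOrder.Language.{u, v}} [L.IsAlgebraic] {Θ : Variety L} {α : Type x} {H : Type w}
  [L.Structure H]

theorem W.single_self (a : α) (t : W Θ α) : W.single a t (W.var Θ a) = t := by
  classical
  simp [W.single, W.lift_var]

theorem W.single_of_ne {a b : α} (h : b ≠ a) (t : W Θ α) :
    W.single a t (W.var Θ b) = W.var Θ b := by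
  classical
  simp [W.single, W.lift_var, h]

/-- Two points that agree on `S` agree on the words in `S`. -/
theorem eq_of_mem_wordsIn {S : Set α} {f g : W Θ α →[L] H}
    (h : ∀ a ∈ S, f (W.var Θ a) = g (W.var Θ a)) {t : W Θ α} (ht : t ∈ wordsIn Θ S) :
    f t = g t := by
  have : Set.EqOn f g (W.var Θ '' S) := by
    rintro _ ⟨a, ha, rfl⟩
    exact h a ha
  exact FirstOrder.Language.Hom.eqOn_closure this ht

/-- A point can be changed arbitrarily at one variable. -/
theorem exists_modify [InVariety Θ H] (f : W Θ α →[L] H) (a : α) (c : H) :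
    ∃ g : W Θ α →[L] H, g (W.var Θ a) = c ∧ ∀ b, b ≠ a → g (W.var Θ b) = f (W.var Θ b) := by
  classical
  refine ⟨W.lift (Function.update (fun b => f (W.var Θ b)) a c), ?_, fun b hb => ?_⟩
  · simp [W.lift_var]
  · simp [W.lift_var, hb]

end PointFacts

/-! ## The multi-sorted algebra of formulas -/

/-- The components `𝔏⁰(X)`, for finite `X ⊆ X⁰`, of the absolutely free algebra over the equalities,
in the signature of multi-sorted Halmos algebras: Boolean operations, the quantifiers `∃ a` with
`a ∈ X`, and the operations `s_*` for all homomorphisms `s : W(X) → W(Y)`. -/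
inductive Raw {L : FirstOrder.Language.{u, v}} [L.IsAlgebraic] (Θ : Variety L) {X0 : Type x} :
    Finset X0 → Type (max u x)
  | eq {X : Finset X0} (t t' : W Θ X) : Raw Θ X
  | bot {X : Finset X0} : Raw Θ X
  | top {X : Finset X0} : Raw Θ X
  | neg {X : Finset X0} (a : Raw Θ X) : Raw Θ X
  | and {X : Finset X0} (a b : Raw Θ X) : Raw Θ X
  | or {X : Finset X0} (a b : Raw Θ X) : Raw Θ X
  | ex {X : Finset X0} (i : X) (a : Raw Θ X) : Raw Θ X
  | star {X Y : Finset X0} (s : W Θ X →[L] W Θ Y) (a : Raw Θ X) : Raw Θ Y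

/-- The conjunction of finitely many formulas. -/
def Raw.conj {L : FirstOrder.Language.{u, v}} [L.IsAlgebraic] {Θ : Variety L} {X0 : Type x} {X : Finset X0} :
    List (Raw Θ X) → Raw Θ X
  | [] => Raw.top
  | a :: l => Raw.and a (Raw.conj l)

/-- The verbal congruence on `𝔏⁰` of the identities of the variety of Halmos algebras, i.e. the
least congruence such that
* every component is an extended Boolean algebra: a Boolean algebra with commuting existential
  quantifiers and with equalities forming a congruence on `W(X)`;
* `s ↦ s_*` is functorial and every `s_*` is a homomorphism of Boolean algebras;
* `s_*` is coordinated with the quantifiers and with the equalities.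
Inequalities `a ≤ b` are written `a ∧ b = a`. -/
inductive Raw.Rel {L : FirstOrder.Language.{u, v}} [L.IsAlgebraic] {Θ : Variety L} {X0 : Type x} :
    {X : Finset X0} → Raw Θ X → Raw Θ X → Prop
  -- equivalence relation, compatible with the operations
  | refl {X : Finset X0} (a : Raw Θ X) : Rel a a
  | symm {X : Finset X0} {a b : Raw Θ X} : Rel a b → Rel b a
  | trans {X : Finset X0} {a b c : Raw Θ X} : Rel a b → Rel b c → Rel a c
  | neg_congr {X : Finset X0} {a b : Raw Θ X} : Rel a b → Rel a.neg b.neg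
  | and_congr {X : Finset X0} {a a' b b' : Raw Θ X} :
      Rel a a' → Rel b b' → Rel (a.and b) (a'.and b')
  | or_congr {X : Finset X0} {a a' b b' : Raw Θ X} :
      Rel a a' → Rel b b' → Rel (a.or b) (a'.or b')
  | ex_congr {X : Finset X0} (i : X) {a b : Raw Θ X} : Rel a b → Rel (a.ex i) (b.ex i)
  | star_congr {X Y : Finset X0} (s : W Θ X →[L] W Θ Y) {a b : Raw Θ X} :
      Rel a b → Rel (a.star s) (b.star s)
  -- Boolean algebra
  | and_comm {X : Finset X0} (a b : Raw Θ X) : Rel (a.and b) (b.and a)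
  | or_comm {X : Finset X0} (a b : Raw Θ X) : Rel (a.or b) (b.or a)
  | and_assoc {X : Finset X0} (a b c : Raw Θ X) : Rel ((a.and b).and c) (a.and (b.and c))
  | or_assoc {X : Finset X0} (a b c : Raw Θ X) : Rel ((a.or b).or c) (a.or (b.or c))
  | and_absorb {X : Finset X0} (a b : Raw Θ X) : Rel (a.and (a.or b)) a
  | or_absorb {X : Finset X0} (a b : Raw Θ X) : Rel (a.or (a.and b)) a
  | and_distrib {X : Finset X0} (a b c : Raw Θ X) :
      Rel (a.and (b.or c)) ((a.and b).or (a.and c))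
  | and_neg {X : Finset X0} (a : Raw Θ X) : Rel (a.and a.neg) Raw.bot
  | or_neg {X : Finset X0} (a : Raw Θ X) : Rel (a.or a.neg) Raw.top
  -- existential quantifiers
  | ex_bot {X : Finset X0} (i : X) : Rel (Raw.ex i Raw.bot) Raw.bot
  | le_ex {X : Finset X0} (i : X) (a : Raw Θ X) : Rel (a.and (a.ex i)) a
  | ex_and_ex {X : Finset X0} (i : X) (a b : Raw Θ X) :
      Rel ((a.and (b.ex i)).ex i) ((a.ex i).and (b.ex i))
  | ex_comm {X : Finset X0} (i j : X) (a : Raw Θ X) : Rel ((a.ex j).ex i) ((a.ex i).ex j)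
  -- equalities
  | eq_refl {X : Finset X0} (t : W Θ X) : Rel (Raw.eq t t) Raw.top
  | eq_symm {X : Finset X0} (t t' : W Θ X) :
      Rel ((Raw.eq t t').and (Raw.eq t' t)) (Raw.eq t t')
  | eq_trans {X : Finset X0} (t t' t'' : W Θ X) :
      Rel (((Raw.eq t t').and (Raw.eq t' t'')).and (Raw.eq t t''))
        ((Raw.eq t t').and (Raw.eq t' t''))
  | eq_fun {X : Finset X0} {n : ℕ} (f : L.Functions n) (ts ts' : Fin n → W Θ X) :
      Rel ((Raw.conj (List.ofFn fun i => Raw.eq (ts i) (ts' i))).and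
          (Raw.eq (FirstOrder.Language.Structure.funMap f ts) (FirstOrder.Language.Structure.funMap f ts')))
        (Raw.conj (List.ofFn fun i => Raw.eq (ts i) (ts' i)))
  -- functoriality
  | star_id {X : Finset X0} (a : Raw Θ X) : Rel (a.star (FirstOrder.Language.Hom.id L (W Θ X))) a
  | star_comp {X Y Z : Finset X0} (s : W Θ X →[L] W Θ Y) (s' : W Θ Y →[L] W Θ Z) (a : Raw Θ X) :
      Rel (a.star (s'.comp s)) ((a.star s).star s')
  -- Boolean homomorphisms
  | star_neg {X Y : Finset X0} (s : W Θ X →[L] W Θ Y) (a : Raw Θ X) :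
      Rel (a.neg.star s) (a.star s).neg
  | star_and {X Y : Finset X0} (s : W Θ X →[L] W Θ Y) (a b : Raw Θ X) :
      Rel ((a.and b).star s) ((a.star s).and (b.star s))
  | star_or {X Y : Finset X0} (s : W Θ X →[L] W Θ Y) (a b : Raw Θ X) :
      Rel ((a.or b).star s) ((a.star s).or (b.star s))
  | star_bot {X Y : Finset X0} (s : W Θ X →[L] W Θ Y) : Rel (Raw.bot.star s) Raw.bot
  | star_top {X Y : Finset X0} (s : W Θ X →[L] W Θ Y) : Rel (Raw.top.star s) Raw.top
  -- `s_*` and quantifiers: `s_* ∃ i a` does not depend on `s(i)`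
  | star_ex_eq {X Y : Finset X0} (s s' : W Θ X →[L] W Θ Y) (i : X)
      (h : ∀ j : X, j ≠ i → s (W.var Θ j) = s' (W.var Θ j)) (a : Raw Θ X) :
      Rel ((a.ex i).star s) ((a.ex i).star s')
  -- `s_* ∃ i a = ∃ s(i) s_* a`, if `s(i)` is a variable that does not occur in the other `s(j)`
  | star_ex {X Y : Finset X0} (s : W Θ X →[L] W Θ Y) (i : X) (k : Y)
      (hk : s (W.var Θ i) = W.var Θ k)
      (h : ∀ j : X, j ≠ i → s (W.var Θ j) ∈ wordsIn Θ ({k}ᶜ : Set Y)) (a : Raw Θ X) :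
      Rel ((a.ex i).star s) ((a.star s).ex k)
  -- `s_*` and equalities
  | star_eq {X Y : Finset X0} (s : W Θ X →[L] W Θ Y) (t t' : W Θ X) :
      Rel ((Raw.eq t t').star s) (Raw.eq (s t) (s t'))
  | star_single {X : Finset X0} (i : X) (t t' : W Θ X) (a : Raw Θ X) :
      Rel (((a.star (W.single i t)).and (Raw.eq t t')).and (a.star (W.single i t')))
        ((a.star (W.single i t)).and (Raw.eq t t'))

/-- The values of the formulas of `𝔏⁰(X)` in the Boolean algebra of all subsets of the affine space
`Hom(W(X), H)`. -/
def Raw.val {L : FirstOrder.Language.{u, v}} [L.IsAlgebraic] {Θ : Variety L} {X0 : Type x}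
    (H : Type w) [L.Structure H] : {X : Finset X0} → Raw Θ X → Set (W Θ X →[L] H)
  | _, .eq t t' => {μ | μ t = μ t'}
  | _, .bot => ∅
  | _, .top => Set.univ
  | _, .neg a => (Raw.val H a)ᶜ
  | _, .and a b => Raw.val H a ∩ Raw.val H b
  | _, .or a b => Raw.val H a ∪ Raw.val H b
  | _, .ex i a => {μ | ∃ ν ∈ Raw.val H a, ∀ j, j ≠ i → μ (W.var Θ j) = ν (W.var Θ j)}
  | _, .star s a => {μ | μ.comp s ∈ Raw.val H a}

theorem Raw.mem_val_conj {L : FirstOrder.Language.{u, v}} [L.IsAlgebraic] {Θ : Variety L} {X0 : Type x}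
    (H : Type w) [L.Structure H] {X : Finset X0} (l : List (Raw Θ X)) (μ : W Θ X →[L] H) :
    μ ∈ Raw.val H (Raw.conj l) ↔ ∀ a ∈ l, μ ∈ Raw.val H a := by
  induction l with
  | nil => simp [Raw.conj, Raw.val]
  | cons a l ih => simp [Raw.conj, Raw.val, ih]

/-- The algebras of subsets of the affine spaces satisfy the identities of Halmos algebras. -/
theorem Raw.Rel.sound {L : FirstOrder.Language.{u, v}} [L.IsAlgebraic] {Θ : Variety L} {X0 : Type x}
    (H : Type w) [L.Structure H] [InVariety Θ H] {X : Finset X0} {a b : Raw Θ X}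
    (h : Raw.Rel a b) : Raw.val H a = Raw.val H b := by
  induction h with
  | refl a => rfl
  | symm _ ih => exact ih.symm
  | trans _ _ ih ih' => exact ih.trans ih'
  | neg_congr _ ih => simp only [Raw.val, ih]
  | and_congr _ _ ih ih' => simp only [Raw.val, ih, ih']
  | or_congr _ _ ih ih' => simp only [Raw.val, ih, ih']
  | ex_congr i _ ih => simp only [Raw.val, ih]
  | star_congr s _ ih => simp only [Raw.val, ih]
  | and_comm a b => exact Set.inter_comm _ _
  | or_comm a b => exact Set.union_comm _ _
  | and_assoc a b c => exact Set.inter_assoc _ _ _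
  | or_assoc a b c => exact Set.union_assoc _ _ _
  | and_absorb a b => ext μ; simp only [Raw.val, Set.mem_inter_iff, Set.mem_union]; tauto
  | or_absorb a b => ext μ; simp only [Raw.val, Set.mem_inter_iff, Set.mem_union]; tauto
  | and_distrib a b c => exact Set.inter_union_distrib_left _ _ _
  | and_neg a => exact Set.inter_compl_self _
  | or_neg a => exact Set.union_compl_self _
  | ex_bot i => ext μ; simp [Raw.val]
  | le_ex i a =>
    refine Set.inter_eq_left.2 fun μ hμ => ⟨μ, hμ, fun _ _ => rfl⟩
  | ex_and_ex i a b =>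
    ext μ
    constructor
    · rintro ⟨ν, ⟨h1, ρ, h2, h3⟩, h4⟩
      exact ⟨⟨ν, h1, h4⟩, ρ, h2, fun j hj => (h4 j hj).trans (h3 j hj)⟩
    · rintro ⟨⟨ν, h1, h2⟩, ρ, h3, h4⟩
      exact ⟨ν, ⟨h1, ρ, h3, fun j hj => (h2 j hj).symm.trans (h4 j hj)⟩, h2⟩
  | @ex_comm X i j a =>
    have key : ∀ i j : X, Raw.val H ((a.ex j).ex i) ⊆ Raw.val H ((a.ex i).ex j) := by
      rintro i j μ ⟨ν, ⟨ρ, h1, h2⟩, h3⟩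
      by_cases hij : i = j
      · subst hij; exact ⟨ν, ⟨ρ, h1, h2⟩, h3⟩
      obtain ⟨σ, hσ, hσ'⟩ := exists_modify μ j (ρ (W.var Θ j))
      refine ⟨σ, ⟨ρ, h1, fun k hk => ?_⟩, fun k hk => (hσ' k hk).symm⟩
      by_cases hkj : k = j
      · subst hkj; exact hσ
      · rw [hσ' k hkj, h3 k hk, h2 k hkj]
    exact Set.Subset.antisymm (key i j) (key j i)
  | eq_refl t => ext μ; simp [Raw.val]
  | eq_symm t t' =>
    refine Set.inter_eq_left.2 fun μ hμ => ?_
    exact Eq.symm hμ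
  | eq_trans t t' t'' =>
    refine Set.inter_eq_left.2 fun μ hμ => ?_
    exact Eq.trans hμ.1 hμ.2
  | eq_fun f ts ts' =>
    refine Set.inter_eq_left.2 fun μ hμ => ?_
    rw [Raw.mem_val_conj] at hμ
    have : ∀ i, μ (ts i) = μ (ts' i) := fun i =>
      hμ (Raw.eq (ts i) (ts' i)) (List.mem_ofFn.2 ⟨i, rfl⟩)
    change μ _ = μ _
    rw [FirstOrder.Language.Hom.map_fun, FirstOrder.Language.Hom.map_fun]
    exact congrArg _ (funext this)
  | star_id a => rfl
  | star_comp s s' a => rfl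
  | star_neg s a => rfl
  | star_and s a b => rfl
  | star_or s a b => rfl
  | star_bot s => rfl
  | star_top s => rfl
  | @star_ex_eq X Y s s' i h a =>
    have key : ∀ s s' : W Θ X →[L] W Θ Y,
        (∀ j : X, j ≠ i → s (W.var Θ j) = s' (W.var Θ j)) →
          Raw.val H ((a.ex i).star s) ⊆ Raw.val H ((a.ex i).star s') := by
      rintro s s' h μ ⟨ν, h1, h2⟩
      refine ⟨ν, h1, fun j hj => ?_⟩
      have h3 : μ (s (W.var Θ j)) = ν (W.var Θ j) := h2 j hj
      rw [h j hj] at h3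
      exact h3
    exact Set.Subset.antisymm (key s s' h) (key s' s fun j hj => (h j hj).symm)
  | star_ex s i k hk h a =>
    ext μ
    constructor
    · rintro ⟨ν, h1, h2⟩
      obtain ⟨σ, hσ, hσ'⟩ := exists_modify μ k (ν (W.var Θ i))
      refine ⟨σ, ?_, fun j hj => (hσ' j hj).symm⟩
      have : σ.comp s = ν := by
        refine W.hom_ext fun j => ?_
        by_cases hj : j = i
        · subst hj
          change σ (s _) = _
          rw [hk, hσ]
        · rw [← h2 j hj]
          exact eq_of_mem_wordsIn (fun b hb => hσ' b hb) (h j hj)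
      change σ.comp s ∈ Raw.val H a
      rw [this]
      exact h1
    · rintro ⟨σ, h1, h2⟩
      refine ⟨σ.comp s, h1, fun j hj => ?_⟩
      exact eq_of_mem_wordsIn (fun b hb => h2 b hb) (h j hj)
  | star_eq s t t' => rfl
  | star_single i t t' a =>
    refine Set.inter_eq_left.2 ?_
    rintro μ ⟨h1, h2⟩
    have : μ.comp (W.single i t) = μ.comp (W.single i t') := by
      refine W.hom_ext fun j => ?_
      change μ (W.single i t _) = μ (W.single i t' _)
      by_cases hj : j = i
      · subst hj
        rw [W.single_self, W.single_self]
        exact h2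
      · rw [W.single_of_ne hj, W.single_of_ne hj]
    change μ.comp (W.single i t') ∈ Raw.val H a
    rw [← this]
    exact h1

abbrev rawSetoid {L : FirstOrder.Language.{u, v}} [L.IsAlgebraic] (Θ : Variety L) {X0 : Type x}
    (X : Finset X0) : Setoid (Raw Θ X) where
  r := Raw.Rel
  iseqv := ⟨Raw.Rel.refl, Raw.Rel.symm, Raw.Rel.trans⟩

/-- The component `Φ(X)` of the multi-sorted algebra of formulas, the free algebra over the
equalities in the variety of Halmos algebras. -/
def Phi {L : FirstOrder.Language.{u, v}} [L.IsAlgebraic] (Θ : Variety L) {X0 : Type x} (X : Finset X0) :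
    Type (max u x) :=
  Quotient (rawSetoid Θ X)

/-- `Val^X_H : Φ(X) → Bool(W(X), H)`. -/
def Phi.val {L : FirstOrder.Language.{u, v}} [L.IsAlgebraic] {Θ : Variety L} {X0 : Type x} {X : Finset X0}
    (H : Type w) [L.Structure H] [InVariety Θ H] : Phi Θ X → Set (W Θ X →[L] H) :=
  Quotient.lift (Raw.val H) (fun _ _ h => Raw.Rel.sound H h)

/-- The logical kernel of a point: the formulas of `Φ(X)` that are valid on it. -/
def LKer {L : FirstOrder.Language.{u, v}} [L.IsAlgebraic] {Θ : Variety L} {X0 : Type x} {X : Finset X0}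
    {H : Type w} [L.Structure H] [InVariety Θ H] (μ : W Θ X →[L] H) : Set (Phi Θ X) :=
  {a | μ ∈ Phi.val H a}

/-! ## The one-sorted algebra of formulas -/

/-- Pure first-order formulas over the equalities `t ≡ t'`, with `t, t' ∈ W(V)`. -/
inductive PureFormula {L : FirstOrder.Language.{u, v}} (Θ : Variety L) (V : Type x) : Type (max u x)
  | eq (t t' : W Θ V) : PureFormula Θ V
  | bot : PureFormula Θ V
  | top : PureFormula Θ V
  | neg (a : PureFormula Θ V) : PureFormula Θ V
  | and (a b : PureFormula Θ V) : PureFormula Θ V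
  | or (a b : PureFormula Θ V) : PureFormula Θ V
  | ex (i : V) (a : PureFormula Θ V) : PureFormula Θ V

namespace PureFormula

variable {L : FirstOrder.Language.{u, v}} [L.IsAlgebraic] {Θ : Variety L} {V : Type x}

/-- `u → v` means `¬ u ∨ v`. -/
def imp (a b : PureFormula Θ V) : PureFormula Θ V := (a.neg).or b

/-- `a.FreeIn S`: every free variable of `a` belongs to `S`. -/
def FreeIn : PureFormula Θ V → Set V → Prop
  | eq t t', S => t ∈ wordsIn Θ S ∧ t' ∈ wordsIn Θ S
  | bot, _ => True
  | top, _ => True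
  | neg a, S => a.FreeIn S
  | and a b, S => a.FreeIn S ∧ b.FreeIn S
  | or a b, S => a.FreeIn S ∧ b.FreeIn S
  | ex i a, S => a.FreeIn (insert i S)

/-- The set of bound variables of a formula. -/
def boundVars : PureFormula Θ V → Set V
  | eq _ _ => ∅
  | bot => ∅
  | top => ∅
  | neg a => a.boundVars
  | and a b => a.boundVars ∪ b.boundVars
  | or a b => a.boundVars ∪ b.boundVars
  | ex i a => insert i a.boundVars

open Classical in
/-- `a.subst i t` replaces the free occurrences of the variable `i` in `a` by `t`. -/
noncomputable def subst (i : V) (t : W Θ V) : PureFormula Θ V → PureFormula Θ V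
  | eq r r' => eq (W.single i t r) (W.single i t r')
  | bot => bot
  | top => top
  | neg a => neg (a.subst i t)
  | and a b => and (a.subst i t) (b.subst i t)
  | or a b => or (a.subst i t) (b.subst i t)
  | ex j a => if j = i then ex j a else ex j (a.subst i t)

/-- `t` is substitutable for `i` in `a`: no variable of `t` is captured by a quantifier. -/
def Substitutable (i : V) (t : W Θ V) : PureFormula Θ V → Prop
  | eq _ _ => True
  | bot => True
  | top => True
  | neg a => a.Substitutable i t
  | and a b => a.Substitutable i t ∧ b.Substitutable i t
  | or a b => a.Substitutable i t ∧ b.Substitutable i t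
  | ex j a => (ex j a).FreeIn {i}ᶜ ∨ (t ∈ wordsIn Θ {j}ᶜ ∧ a.Substitutable i t)

/-- A truth assignment to formulas that respects the Boolean connectives. -/
structure IsTruthAssignment (τ : PureFormula Θ V → Prop) : Prop where
  bot : ¬ τ bot
  top : τ top
  neg : ∀ a, τ (neg a) ↔ ¬ τ a
  and : ∀ a b, τ (and a b) ↔ τ a ∧ τ b
  or : ∀ a b, τ (or a b) ↔ τ a ∨ τ b

/-- Deducibility in first-order logic with equality (axioms: propositional tautologies,
substitution, equality; rules: modus ponens, introduction of `∃`). The identities of `Θ` are already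
built into the elements of `W(V)`. -/
inductive Deducible : PureFormula Θ V → Prop
  | taut (a : PureFormula Θ V) (h : ∀ τ : PureFormula Θ V → Prop, IsTruthAssignment τ → τ a) : Deducible a
  | ex_of_subst (a : PureFormula Θ V) (i : V) (t : W Θ V) (h : a.Substitutable i t) :
      Deducible (imp (a.subst i t) (ex i a))
  | eq_refl (t : W Θ V) : Deducible (eq t t)
  | eq_subst (i : V) (t t' r r' : W Θ V) :
      Deducible (imp (eq t t') (imp ((eq r r').subst i t) ((eq r r').subst i t')))
  | mp {a b : PureFormula Θ V} : Deducible (imp a b) → Deducible a → Deducible b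
  | ex_elim {a b : PureFormula Θ V} (i : V) (h : b.FreeIn {i}ᶜ) :
      Deducible (imp a b) → Deducible (imp (ex i a) b)

/-- The set of points `W(V) → H` satisfying a formula. -/
def val (H : Type w) [L.Structure H] : PureFormula Θ V → Set (W Θ V →[L] H)
  | eq t t' => {η | η t = η t'}
  | bot => ∅
  | top => Set.univ
  | neg a => (a.val H)ᶜ
  | and a b => a.val H ∩ b.val H
  | or a b => a.val H ∪ b.val H
  | ex i a => {η | ∃ ν ∈ a.val H, ∀ j, j ≠ i → η (W.var Θ j) = ν (W.var Θ j)}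

variable {H : Type w} [L.Structure H]

theorem mem_val_imp {a b : PureFormula Θ V} {η : W Θ V →[L] H} :
    η ∈ (imp a b).val H ↔ (η ∈ a.val H → η ∈ b.val H) :=
  imp_iff_not_or.symm

/-- Satisfaction depends only on the values at the free variables. -/
theorem FreeIn.val_congr [InVariety Θ H] {a : PureFormula Θ V} {S : Set V} (h : a.FreeIn S)
    {η ν : W Θ V →[L] H} (hη : ∀ j ∈ S, η (W.var Θ j) = ν (W.var Θ j)) :
    η ∈ a.val H ↔ ν ∈ a.val H := by
  induction a generalizing S η ν with
  | eq t t' =>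
    change η t = η t' ↔ ν t = ν t'
    rw [eq_of_mem_wordsIn hη h.1, eq_of_mem_wordsIn hη h.2]
  | bot => exact Iff.rfl
  | top => exact iff_of_true trivial trivial
  | neg a ih => exact not_congr (ih h hη)
  | and a b iha ihb => exact and_congr (iha h.1 hη) (ihb h.2 hη)
  | or a b iha ihb => exact or_congr (iha h.1 hη) (ihb h.2 hη)
  | ex i a ih =>
    have key : ∀ η ν : W Θ V →[L] H, (∀ j ∈ S, η (W.var Θ j) = ν (W.var Θ j)) →
        η ∈ (ex i a).val H → ν ∈ (ex i a).val H := by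
      rintro η ν hη ⟨ρ, h1, h2⟩
      obtain ⟨σ, hσ, hσ'⟩ := exists_modify ν i (ρ (W.var Θ i))
      refine ⟨σ, (ih h ?_).1 h1, fun j hj => (hσ' j hj).symm⟩
      intro j hj
      by_cases hji : j = i
      · subst hji; exact hσ.symm
      · rw [hσ' j hji, ← hη j (hj.resolve_left hji), h2 j hji]
    exact ⟨key η ν hη, key ν η fun j hj => (hη j hj).symm⟩

theorem FreeIn.subst_val [InVariety Θ H] {a : PureFormula Θ V} {i : V} (t : W Θ V)
    (h : a.FreeIn {i}ᶜ) : (a.subst i t).val H = a.val H := by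
  have hw : ∀ r ∈ wordsIn Θ ({i}ᶜ : Set V), W.single i t r = r := fun r hr =>
    eq_of_mem_wordsIn (g := FirstOrder.Language.Hom.id L (W Θ V)) (fun j hj => W.single_of_ne hj t) hr
  induction a with
  | eq r r' => simp only [subst, hw r h.1, hw r' h.2]
  | bot => rfl
  | top => rfl
  | neg a ih => simp only [subst, val, ih h]
  | and a b iha ihb => simp only [subst, val, iha h.1, ihb h.2]
  | or a b iha ihb => simp only [subst, val, iha h.1, ihb h.2]
  | ex j a ih =>
    by_cases hj : j = i
    · simp only [subst, if_pos hj]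
    · have : insert j ({i}ᶜ : Set V) = {i}ᶜ := Set.insert_eq_of_mem hj
      have h' : a.FreeIn {i}ᶜ := by
        have h2 : a.FreeIn (insert j {i}ᶜ) := h
        rwa [this] at h2
      simp only [subst, if_neg hj, val, ih h']

theorem Substitutable.mem_val [InVariety Θ H] {a : PureFormula Θ V} {i : V} {t : W Θ V}
    (h : a.Substitutable i t) (η : W Θ V →[L] H) :
    η ∈ (a.subst i t).val H ↔ η.comp (W.single i t) ∈ a.val H := by
  have hne : ∀ (ρ : W Θ V →[L] H) (k : V), k ≠ i →
      ρ.comp (W.single i t) (W.var Θ k) = ρ (W.var Θ k) := fun ρ k hk =>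
    congrArg ρ (W.single_of_ne hk t)
  have hself : ∀ ρ : W Θ V →[L] H, ρ.comp (W.single i t) (W.var Θ i) = ρ t := fun ρ =>
    congrArg ρ (W.single_self i t)
  induction a generalizing η with
  | eq r r' => exact Iff.rfl
  | bot => exact Iff.rfl
  | top => exact Iff.rfl
  | neg a ih => exact not_congr (ih h η)
  | and a b iha ihb => exact and_congr (iha h.1 η) (ihb h.2 η)
  | or a b iha ihb => exact or_congr (iha h.1 η) (ihb h.2 η)
  | ex j a ih =>
    by_cases hfree : (ex j a).FreeIn {i}ᶜ
    · rw [hfree.subst_val t]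
      exact hfree.val_congr fun k hk => (hne η k hk).symm
    by_cases hj : j = i
    · subst hj
      simp only [subst, if_pos]
      constructor
      · rintro ⟨ν, h1, h2⟩
        exact ⟨ν, h1, fun k hk => (hne η k hk).trans (h2 k hk)⟩
      · rintro ⟨ν, h1, h2⟩
        exact ⟨ν, h1, fun k hk => (hne η k hk).symm.trans (h2 k hk)⟩
    · obtain ⟨ht, ha⟩ := h.resolve_left hfree
      have htw : ∀ ρ σ : W Θ V →[L] H, (∀ k, k ≠ j → ρ (W.var Θ k) = σ (W.var Θ k)) →
          ρ t = σ t := fun ρ σ hρ => eq_of_mem_wordsIn (fun k hk => hρ k hk) ht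
      simp only [subst, if_neg hj]
      constructor
      · rintro ⟨ν, h1, h2⟩
        refine ⟨ν.comp (W.single i t), (ih ha ν).1 h1, fun k hk => ?_⟩
        by_cases hki : k = i
        · subst hki
          rw [hself, hself]
          exact htw _ _ h2
        · rw [hne η k hki, hne ν k hki]
          exact h2 k hk
      · rintro ⟨ν, h1, h2⟩
        obtain ⟨σ, hσ, hσ'⟩ := exists_modify η j (ν (W.var Θ j))
        refine ⟨σ, (ih ha σ).2 ?_, fun k hk => (hσ' k hk).symm⟩
        have : σ.comp (W.single i t) = ν := by
          refine W.hom_ext fun k => ?_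
          by_cases hki : k = i
          · subst hki
            rw [hself, htw σ η hσ', ← h2 k fun e => hj e.symm, hself]
          · rw [hne σ k hki]
            by_cases hkj : k = j
            · subst hkj; exact hσ
            · rw [hσ' k hkj, ← h2 k hkj, hne η k hki]
        rw [this]
        exact h1

theorem isTruthAssignment_mem (η : W Θ V →[L] H) :
    IsTruthAssignment (fun a : PureFormula Θ V => η ∈ a.val H) where
  bot := fun h => h
  top := trivial
  neg := fun _ => Iff.rfl
  and := fun _ _ => Iff.rfl
  or := fun _ _ => Iff.rfl

/-- Deducible formulas are valid in all algebras of `Θ`. -/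
theorem Deducible.sound [InVariety Θ H] {a : PureFormula Θ V} (h : Deducible a) (η : W Θ V →[L] H) :
    η ∈ a.val H := by
  induction h generalizing η with
  | taut a h => exact h _ (isTruthAssignment_mem η)
  | ex_of_subst a i t h =>
    refine mem_val_imp.2 fun h1 => ⟨_, (h.mem_val η).1 h1, fun j hj => ?_⟩
    exact (congrArg η (W.single_of_ne hj t)).symm
  | eq_refl t => rfl
  | eq_subst i t t' r r' =>
    refine mem_val_imp.2 fun h1 => mem_val_imp.2 fun h2 => ?_
    have hs : ∀ q : W Θ V, (eq r r').Substitutable i q := fun _ => trivial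
    rw [(hs _).mem_val] at h2 ⊢
    have : η.comp (W.single i t) = η.comp (W.single i t') := by
      refine W.hom_ext fun j => ?_
      change η (W.single i t _) = η (W.single i t' _)
      by_cases hj : j = i
      · subst hj
        rw [W.single_self, W.single_self]
        exact h1
      · rw [W.single_of_ne hj, W.single_of_ne hj]
    rw [← this]
    exact h2
  | mp _ _ ih ih' => exact mem_val_imp.1 (ih η) (ih' η)
  | @ex_elim a b i h _ ih =>
    refine mem_val_imp.2 ?_
    rintro ⟨ν, h1, h2⟩
    exact (h.val_congr fun j hj => (h2 j hj)).2 (mem_val_imp.1 (ih ν) h1)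

end PureFormula

/-- The Lindenbaum-Tarski congruence: `u` and `v` are identified if `(u → v) ∧ (v → u)` is
deducible. -/
abbrev pureSetoid {L : FirstOrder.Language.{u, v}} [L.IsAlgebraic] (Θ : Variety L) (V : Type x) :
    Setoid (PureFormula Θ V) where
  r a b := PureFormula.Deducible ((a.imp b).and (b.imp a))
  iseqv :=
    { refl := fun a => .taut _ fun τ h => by
        simp only [PureFormula.imp, h.and, h.or, h.neg]; tauto
      symm := fun {a b} hab => .mp (.taut _ fun τ h => by
        simp only [PureFormula.imp, h.and, h.or, h.neg]; tauto) hab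
      trans := fun {a b c} hab hbc => .mp (.mp (.taut
        (((a.imp b).and (b.imp a)).imp
          (((b.imp c).and (c.imp b)).imp ((a.imp c).and (c.imp a)))) fun τ h => by
        simp only [PureFormula.imp, h.and, h.or, h.neg]; tauto) hab) hbc }

/-- The one-sorted algebra of formulas `Φ(X⁰)`. -/
def Phi0 {L : FirstOrder.Language.{u, v}} [L.IsAlgebraic] (Θ : Variety L) (X0 : Type x) : Type (max u x) :=
  Quotient (pureSetoid Θ X0)

/-- `Val^{X⁰}_H`: the set of points `W(X⁰) → H` satisfying an element of `Φ(X⁰)`. -/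
def Phi0.val {L : FirstOrder.Language.{u, v}} [L.IsAlgebraic] {Θ : Variety L} {X0 : Type x}
    (H : Type w) [L.Structure H] [InVariety Θ H] : Phi0 Θ X0 → Set (W Θ X0 →[L] H) :=
  Quotient.lift (PureFormula.val H) (fun _ _ hab => by
    ext η
    have h := PureFormula.Deducible.sound hab η
    exact ⟨PureFormula.mem_val_imp.1 h.1, PureFormula.mem_val_imp.1 h.2⟩)

/-- An element of `Φ(X⁰)` is `X`-special if it is the class of a formula all of whose free variables
belong to `X` and all of whose bound variables belong to `Y⁰ = X⁰ \ X`. -/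
def IsSpecial {L : FirstOrder.Language.{u, v}} [L.IsAlgebraic] {Θ : Variety L} {X0 : Type x} (X : Finset X0)
    (a : Phi0 Θ X0) : Prop :=
  ∃ φ : PureFormula Θ X0, Quotient.mk (pureSetoid Θ X0) φ = a ∧
    φ.FreeIn (X : Set X0) ∧ φ.boundVars ⊆ (X : Set X0)ᶜ

/-- The model-theoretic type `Tp^H(μ)`: the `X`-special formulas `u(x₁, …, xₙ; y₁, …, yₘ)` such that
`u(μ(x₁), …, μ(xₙ); y₁, …, yₘ)` is satisfied in `H`, that is, such that all points `η : W(X⁰) → H`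
with `η(xᵢ) = μ(xᵢ)` satisfy `u`. -/
def Tp {L : FirstOrder.Language.{u, v}} [L.IsAlgebraic] {Θ : Variety L} {X0 : Type x} {X : Finset X0}
    {H : Type w} [L.Structure H] [InVariety Θ H] (μ : W Θ X →[L] H) : Set (Phi0 Θ X0) :=
  {a | IsSpecial X a ∧
    ∀ η : W Θ X0 →[L] H, (∀ i : X, η (W.var Θ (i : X0)) = μ (W.var Θ i)) → η ∈ Phi0.val H a}

end LogGeom

namespace LogGeom

/-! ### Subalgebras generated by sets of variables. -/

section Translation

variable {L : FirstOrder.Language.{u, v}} [L.IsAlgebraic] {Θ : Variety L}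

/-! Multi-sorted formulas differ from pure ones only by the operations `s_*`, which can be pushed
inward until they act on the equalities alone. The translation therefore carries a pending
substitution. By induction on `a`, `Raw.exists_pureFormula` gives, for every `s : W(X) → W(X⁰)`
whose values are words over a finite set `B`, a pure formula `φ` that holds at `η` exactly when `a`
holds at `η ∘ s`. An operation `r_*` merely replaces `s` by `s ∘ r`.

The quantifier `∃ i` is the one real case. Its bound variable is renamed to some `y` outside `B`,
available because `X⁰` is infinite; `s` is redirected to send `i` to `y`, and `B` grows by `y`.
Freshness prevents capture: changing a point at `y` does not affect `s`. It also keeps the bound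
variables away from `B`, which becomes the `X`-special condition when `B = X` and `s` is the
inclusion of `W(X)` into `W(X⁰)`.

For that `s`, `η ∘ s = μ` says that `η` extends `μ`, so all extensions of `μ` give `φ` the same
truth value. Nonemptiness of the algebra provides at least one extension (`exists_extend_point`), so
the universal quantifier in `Tp` is not vacuous. The argument is purely semantic, and `φ` is built
before any algebra is chosen. -/

theorem wordsIn_mono {V : Type*} {S T : Set V} (h : S ⊆ T) : wordsIn Θ S ≤ wordsIn Θ T :=
  FirstOrder.Language.Substructure.closure_mono (Set.image_mono h)

theorem var_mem_wordsIn {V : Type*} {S : Set V} {j : V} (h : j ∈ S) : W.var Θ j ∈ wordsIn Θ S :=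
  FirstOrder.Language.Substructure.subset_closure ⟨j, h, rfl⟩

/-- A homomorphism that sends all variables into a subalgebra has its range in that subalgebra. -/
theorem W.hom_mem_of_var {α H : Type*} [L.Structure H] (s : W Θ α →[L] H) (M : L.Substructure H)
    (h : ∀ j, s (W.var Θ j) ∈ M) (t : W Θ α) : s t ∈ M := by
  obtain ⟨t, rfl⟩ := W.exists_mk t
  induction t with
  | var j => exact h j
  | func F ts ih =>
    rw [← W.funMap_mk, FirstOrder.Language.Hom.map_fun]
    exact M.fun_mem F _ ih

/-! ### Translation into pure first-order formulas. -/

/-- Under every substitution `s : W(X) → W(X⁰)` with values in the words over a finite set `B` of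
variables, a multi-sorted formula `a` over `X` has a pure first-order translation with free
variables in `B` and bound variables outside `B`. -/
theorem Raw.exists_pureFormula {X0 : Type x} [Infinite X0] {X : Finset X0} (a : Raw Θ X)
    (B : Finset X0) (s : W Θ X →[L] W Θ X0) (hs : ∀ t, s t ∈ wordsIn Θ (B : Set X0)) :
    ∃ φ : PureFormula Θ X0, φ.FreeIn (B : Set X0) ∧ φ.boundVars ⊆ (B : Set X0)ᶜ ∧
      ∀ (H : Type w) [L.Structure H] [InVariety Θ H] (η : W Θ X0 →[L] H),
        η ∈ φ.val H ↔ η.comp s ∈ Raw.val H a := by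
  classical
  -- Both `B` and `s` must vary: `∃` changes the two of them, and `s_*` changes even the sort of the
  -- source. `s` is generalized together with the index `X`.
  induction a generalizing B with
  | eq t t' =>
    exact ⟨.eq (s t) (s t'), ⟨hs t, hs t'⟩, Set.empty_subset _, fun H _ _ η => Iff.rfl⟩
  | bot => exact ⟨.bot, trivial, Set.empty_subset _, fun H _ _ η => Iff.rfl⟩
  | top => exact ⟨.top, trivial, Set.empty_subset _, fun H _ _ η => Iff.rfl⟩
  | neg a ih =>
    obtain ⟨φ, hf, hb, hv⟩ := ih B s hs
    exact ⟨.neg φ, hf, hb, fun H _ _ η => not_congr (hv H η)⟩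
  | and a b iha ihb =>
    obtain ⟨φ, hf, hb, hv⟩ := iha B s hs
    obtain ⟨ψ, hf', hb', hv'⟩ := ihb B s hs
    exact ⟨.and φ ψ, ⟨hf, hf'⟩, Set.union_subset hb hb',
      fun H _ _ η => and_congr (hv H η) (hv' H η)⟩
  | or a b iha ihb =>
    obtain ⟨φ, hf, hb, hv⟩ := iha B s hs
    obtain ⟨ψ, hf', hb', hv'⟩ := ihb B s hs
    exact ⟨.or φ ψ, ⟨hf, hf'⟩, Set.union_subset hb hb',
      fun H _ _ η => or_congr (hv H η) (hv' H η)⟩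
  | @ex X i a ih =>
    -- The variable `i` itself may lie in `B` or occur in the other values of `s`, so a fresh name
    -- is needed.
    obtain ⟨y, hy⟩ := Infinite.exists_notMem_finset B
    -- A substitution is a point of the algebra `W(X⁰)`, which lies in `Θ`, so it can be modified at
    -- one variable.
    obtain ⟨s', hs'i, hs'⟩ := exists_modify s i (W.var Θ y)
    have hwords : ∀ t, s' t ∈ wordsIn Θ ((insert y B : Finset X0) : Set X0) := by
      refine W.hom_mem_of_var s' _ fun j => ?_
      by_cases hj : j = i
      · subst hj
        rw [hs'i]
        exact var_mem_wordsIn (by simp)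
      · rw [hs' j hj]
        exact wordsIn_mono (by simp) (hs _)
    obtain ⟨φ, hf, hb, hv⟩ := ih (insert y B) s' hwords
    rw [Finset.coe_insert] at hf hb
    -- The use of freshness: words over `B` do not involve `y`.
    have hcongr : ∀ (H : Type w) [L.Structure H] (η ν : W Θ X0 →[L] H),
        (∀ j, j ≠ y → η (W.var Θ j) = ν (W.var Θ j)) → ∀ t, η (s t) = ν (s t) :=
      fun H _ η ν h t => eq_of_mem_wordsIn
        (fun j hj => h j fun e => hy (e ▸ Finset.mem_coe.1 hj)) (hs t)
    -- `hf` serves unchanged, since `FreeIn` for `∃ y` allows `y` in addition to `B`. The bound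
    -- variables of `φ` avoid even `B ∪ {y}`.
    refine ⟨.ex y φ, hf, Set.insert_subset hy
      (hb.trans (Set.compl_subset_compl.2 (Set.subset_insert _ _))), fun H _ _ η => ⟨?_, ?_⟩⟩
    · rintro ⟨ν, h1, h2⟩
      refine ⟨ν.comp s', (hv H ν).1 h1, fun j hj => ?_⟩
      change η (s _) = ν (s' _)
      rw [hs' j hj]
      exact hcongr H η ν h2 _
    · rintro ⟨ρ, h1, h2⟩
      -- The witness `ρ` lives on `W(X)`; it is recovered as `ν ∘ s'` once `y` receives the value
      -- `ρ` has at `i`.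
      obtain ⟨ν, hνy, hν⟩ := exists_modify η y (ρ (W.var Θ i))
      refine ⟨ν, (hv H ν).2 ?_, fun j hj => (hν j hj).symm⟩
      have : ν.comp s' = ρ := by
        refine W.hom_ext fun j => ?_
        change ν (s' _) = _
        by_cases hj : j = i
        · subst hj
          rw [hs'i, hνy]
        · rw [hs' j hj, hcongr H ν η hν]
          exact h2 j hj
      rw [this]
      exact h1
  -- No connective is added: `r_* a` at `η ∘ s` is by definition `a` at `η ∘ s ∘ r`.
  | star r a ih => exact ih B (s.comp r) fun t => hs (r t)

/-! ### Extension of points and correctness of formulas. -/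

/-- Points of `W(X)` in a nonempty algebra extend to points of `W(X⁰)`. -/
theorem exists_extend_point {X0 : Type*} {X : Finset X0} {H : Type*} [L.Structure H] [Nonempty H]
    [InVariety Θ H] (μ : W Θ X →[L] H) :
    ∃ η : W Θ X0 →[L] H, ∀ i : X, η (W.var Θ (i : X0)) = μ (W.var Θ i) := by
  classical
  refine ⟨W.lift fun j => if h : j ∈ X then μ (W.var Θ ⟨j, h⟩) else Classical.arbitrary H,
    fun i => ?_⟩
  simp [W.lift_var]

end Translation

end LogGeom

theorem theorem3p17 {L : FirstOrder.Language.{u, v}} [L.IsAlgebraic] (Θ : LogGeom.Variety L)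
    {X0 : Type x} [Infinite X0] (X : Finset X0) (a : LogGeom.Phi Θ X) :
    ∃ b : LogGeom.Phi0 Θ X0, LogGeom.IsSpecial X b ∧
      ∀ (H : Type w) [L.Structure H] [Nonempty H] [LogGeom.InVariety Θ H]
        (μ : LogGeom.W Θ X →[L] H), a ∈ LogGeom.LKer μ ↔ b ∈ LogGeom.Tp μ := by
  -- Any representative will do, since `Phi.val` depends only on the class.
  obtain ⟨a, rfl⟩ := Quotient.exists_rep a
  let s : LogGeom.W Θ X →[L] LogGeom.W Θ X0 :=
    LogGeom.W.lift fun i => LogGeom.W.var Θ (i : X0)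
  obtain ⟨φ, hf, hb, hv⟩ := a.exists_pureFormula X s
    (LogGeom.W.hom_mem_of_var s _ fun i => LogGeom.var_mem_wordsIn i.2)
  have hspecial : LogGeom.IsSpecial X (Quotient.mk (LogGeom.pureSetoid Θ X0) φ) :=
    ⟨φ, rfl, hf, hb⟩
  refine ⟨_, hspecial, fun H _ _ _ μ => ?_⟩
  -- Extending `μ` means restricting to it along `s`, so `φ` cannot distinguish two extensions.
  have key : ∀ η : LogGeom.W Θ X0 →[L] H,
      (∀ i : X, η (LogGeom.W.var Θ (i : X0)) = μ (LogGeom.W.var Θ i)) →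
        (η ∈ φ.val H ↔ μ ∈ a.val H) := by
    intro η hη
    have : η.comp s = μ := LogGeom.W.hom_ext hη
    rw [hv H η, this]
  refine ⟨fun h => ⟨hspecial, fun η hη => (key η hη).2 h⟩, fun h => ?_⟩
  -- One extension suffices to read `a` back from the universal condition in `Tp`.
  obtain ⟨η, hη⟩ := LogGeom.exists_extend_point μ
  exact (key η hη).1 (h.2 η hη)
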